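/- For a non-integer real number $\beta>1$ and a sequence $E=(E(0),E(1),\dots)\in\{0,1\}^{\mathbb N}$, let $I_\beta(x)=\lfloor\beta x\rfloor$ and define the generalized $\beta$-map $\tau_{\beta,E}:[0,1]\to[0,1]$ by $$\tau_{\beta,E}(x)=E(I_\beta(x))+(-1)^{E(I_\beta(x))}\{\beta x\},$$ where $\{y\}$ is the fractional part of $y$. Put $d_n=E(I_\beta(\tau_{\beta,E}^n(1)))+I_\beta(\tau_{\beta,E}^n(1))$, $e_n=(-1)^{E(I_\beta(\tau_{\beta,E}^n(1)))}$, $s_n=\prod_{i=0}^{n-1}e_i$ (so $s_0=1$), and $EP=\{1/\beta,\dots,\lfloor\beta\rfloor/\beta\}$. The number $\beta$ is a generalized Parry number with respect to $E$ if the orbit $\{\tau_{\beta,E}^n(1):n\ge0\}$ is finite, and it is simple with respect to $E$ if $\tau_{\beta,E}^n(1)\in EP$ for some $n\ge1$. Let $$\phi_{\beta,E}(z)=\sum_{n=0}^{N-1}s_nd_nz^{n+1}+\beta\,\tau_{\beta,E}^N(1)\,s_Nz^{N+1},\qquad N=\min\{n\ge1:\tau_{\beta,E}^n(1)\in EP\},$$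 if $\beta$ is simple, and $\phi_{\beta,E}(z)=\sum_{n=0}^\infty s_nd_nz^{n+1}$ otherwise. Let $\Phi(E)$ (respectively $\hat\Phi(E)$) be the closure in $\mathbb C$ of the set of all Galois conjugates over $\mathbb Q$, other than $\beta$ itself, of the simple generalized Parry numbers (respectively of all generalized Parry numbers) $\beta$ with respect to $E$. Let $\Phi^*(E)$ be the closure of the set of all $z^{-1}$ such that, for some non-integer $\beta>1$, $z\ne\beta^{-1}$ is a zero of $1-\phi_{\beta,E}$; here $\phi_{\beta,E}$ is evaluated where its series converges, and through its rational extension where it has one. Let $\mathbb D$ be the open unit disk in $\mathbb C$, let $\mathcal G_{[-1,1]}$ be the set of $z\in\mathbb D$ for which there are $a_1,a_2,\dots\in[-1,1]$ with $1+\sum_{n\ge1}a_nz^n=0$, and let $\mathcal G_{[-1,1]}^{-1}=\{z^{-1}:z\in\mathcal G_{[-1,1]}\}$. Let $E_{alt}=(0,1,0,1,0,1,\dots)$. Then $$\Phi(E_{alt})=\hat\Phi(E_{alt})=\Phi^*(E_{alt})=\operatorname{clos}(\mathbb D)\cup\mathcal G_{[-1,1]}^{-1},$$ and, moreover, $\Phi(E_{alt})=\bigcup_{E\in\{0,1\}^{\mathbb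 N}}\Phi(E)$. -/

import Mathlib

namespace GenBeta

noncomputable section

/-- The standing assumption on the base: `β > 1` is not an integer. -/
def Admissible (β : ℝ) : Prop := 1 < β ∧ ∀ n : ℤ, β ≠ n

/-- `I_β(x) = [β x]`, for `x ∈ [0,1]`. -/
def branch (β x : ℝ) : ℕ := ⌊β * x⌋₊

/-- The generalized `β`-map `τ_{β,E}(x) = E(I_β(x)) + (-1)^{E(I_β(x))} {β x}` of a 0-1 sequence `E`.
It is only ever used on `[0,1]`, which it maps into itself (`tau_mem_Icc`). -/
def tau (β : ℝ) (E : ℕ → Fin 2) (x : ℝ) : ℝ :=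
  ((E (branch β x) : ℕ) : ℝ) + (-1) ^ (E (branch β x) : ℕ) * Int.fract (β * x)

theorem tau_mem_Icc (β : ℝ) (E : ℕ → Fin 2) (x : ℝ) : tau β E x ∈ Set.Icc (0 : ℝ) 1 := by
  have h0 := Int.fract_nonneg (β * x)
  have h1 := Int.fract_lt_one (β * x)
  unfold tau
  generalize E (branch β x) = e
  fin_cases e <;> constructor <;> simp <;> linarith

/-- `orbit β E n = τ_{β,E}^n(1)`. -/
def orbit (β : ℝ) (E : ℕ → Fin 2) (n : ℕ) : ℝ := (tau β E)^[n] 1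

/-- The digit `d_n(β,E,1)`. -/
def digit (β : ℝ) (E : ℕ → Fin 2) (n : ℕ) : ℕ :=
  (E (branch β (orbit β E n)) : ℕ) + branch β (orbit β E n)

/-- The sign `e_n(β,E,1)`. -/
def sgn (β : ℝ) (E : ℕ → Fin 2) (n : ℕ) : ℤ := (-1) ^ (E (branch β (orbit β E n)) : ℕ)

/-- The cumulative sign `s_n(β,E,1)`, with `s_0 = 1`. -/
def cumSgn (β : ℝ) (E : ℕ → Fin 2) (n : ℕ) : ℤ := ∏ i ∈ Finset.range n, sgn β E i

/-- The interior end points `{1/β, …, [β]/β}` of the monotonicity intervals. -/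
def EP (β : ℝ) : Set ℝ := {x | ∃ k : ℕ, 1 ≤ k ∧ k ≤ ⌊β⌋₊ ∧ x = k / β}

/-- `β` is a generalized Parry number with respect to `E`: the orbit of `1` is a finite set. -/
def IsGenParry (β : ℝ) (E : ℕ → Fin 2) : Prop :=
  Admissible β ∧ (Set.range (orbit β E)).Finite

/-- `β` is simple with respect to `E`: the orbit of `1` eventually falls into `EP`. -/
def IsSimple (β : ℝ) (E : ℕ → Fin 2) : Prop :=
  Admissible β ∧ ∃ n : ℕ, 1 ≤ n ∧ orbit β E n ∈ EP β

/-- `N = min {n ≥ 1 ; τ_{β,E}^n(1) ∈ EP}`; used only when this set is non-empty. -/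
def firstHit (β : ℝ) (E : ℕ → Fin 2) : ℕ := sInf {n : ℕ | 1 ≤ n ∧ orbit β E n ∈ EP β}

open Classical in
/-- The formal power series `φ_{τ_{β,E}}`: a polynomial if `β` is simple, and
`∑_{n ≥ 0} s_n d_n z^{n+1}` otherwise. -/
def phi (β : ℝ) (E : ℕ → Fin 2) : PowerSeries ℂ :=
  if IsSimple β E then
    (∑ n ∈ Finset.range (firstHit β E),
      PowerSeries.C ((cumSgn β E n : ℂ) * (digit β E n : ℂ)) * PowerSeries.X ^ (n + 1))
    + PowerSeries.C (((β * orbit β E (firstHit β E) : ℝ) : ℂ) * (cumSgn β E (firstHit β E) : ℂ))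
      * PowerSeries.X ^ (firstHit β E + 1)
  else
    PowerSeries.X * PowerSeries.mk (fun n => (cumSgn β E n : ℂ) * (digit β E n : ℂ))

/-- `z` is a zero of the function defined by the power series `F`: either `F` converges at `z`
with sum `0`, or `F` extends to a rational function `P / Q` (in lowest terms) that vanishes
at `z`. -/
def IsZeroOf (F : PowerSeries ℂ) (z : ℂ) : Prop :=
  HasSum (fun n : ℕ => PowerSeries.coeff n F * z ^ n) 0 ∨
  ∃ P Q : Polynomial ℂ, IsCoprime P Q ∧ (Q : PowerSeries ℂ) * F = (P : PowerSeries ℂ) ∧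
    P.eval z = 0

/-- The Galois conjugates of an algebraic real number `β`, other than `β` itself: the complex
numbers `z ≠ β` with the same minimal polynomial over `ℚ`. -/
def galoisConjugates (β : ℝ) : Set ℂ :=
  {z | IsAlgebraic ℚ β ∧ IsConjRoot ℚ (β : ℂ) z ∧ z ≠ (β : ℂ)}

/-- `Φ(E)`. -/
def Phi (E : ℕ → Fin 2) : Set ℂ :=
  closure {z | ∃ β : ℝ, IsSimple β E ∧ z ∈ galoisConjugates β}

/-- `Φ̂(E)`. -/
def PhiHat (E : ℕ → Fin 2) : Set ℂ :=
  closure {z | ∃ β : ℝ, IsGenParry β E ∧ z ∈ galoisConjugates β}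

/-- `Φ*(E)`: the closure of the set of reciprocals of the zeros of `1 - φ_{τ_{β,E}}` other than
the trivial zero `1/β`, for all admissible `β`. -/
def PhiStar (E : ℕ → Fin 2) : Set ℂ :=
  closure {w | ∃ β : ℝ, Admissible β ∧
    ∃ z : ℂ, IsZeroOf (1 - phi β E) z ∧ z ≠ ((β : ℂ))⁻¹ ∧ w = z⁻¹}

/-- `𝓕_I`: the power series `1 + ∑_{n ≥ 1} a_n z^n` with all `a_n ∈ I`. -/
def FF (I : Set ℝ) : Set (PowerSeries ℝ) :=
  {f | PowerSeries.coeff 0 f = 1 ∧ ∀ n : ℕ, 1 ≤ n → PowerSeries.coeff n f ∈ I}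

/-- `𝓖_I`: the zeros of members of `𝓕_I` in the open unit disk. -/
def GG (I : Set ℝ) : Set ℂ :=
  {z | z ∈ Metric.ball (0 : ℂ) 1 ∧
    ∃ f ∈ FF I, HasSum (fun n : ℕ => ((PowerSeries.coeff n f : ℝ) : ℂ) * z ^ n) 0}

/-- `A^{-1} = {z^{-1} ; z ∈ A}`. -/
def invSet (A : Set ℂ) : Set ℂ := (fun z : ℂ => z⁻¹) '' A

/-- `E_alt = (0,1,0,1,…)`. -/
def Ealt : ℕ → Fin 2 := fun n => if Even n then 0 else 1

end

end GenBeta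

/-!
The signed orbit `s_n τ^n(1)` is `q_n(β)`, where the monic integer polynomials `q_n` arise from the
digits `s_n d_n` by Horner's scheme, and formally
`1 - φ(z) = (1 - x z) ∑ q_n(x) z^n` for every number `x`.
With `x = β` this shows, as `|q_n(β)| ≤ 1`, that the zeros of `1 - φ` in the unit disk other than
`1/β` lie in `𝓖`. If `x` with `|x| > 1` is a conjugate of a generalized Parry number `β`, then
`q_n(x)` takes only finitely many values, as `q_n(β)` does, so the factorization shows
`1 - φ(1/x) = 0`. Hence all the sets in question lie in `clos 𝔻 ∪ 𝓖⁻¹`, which is closed because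
`𝓖` is the zero set of a compact family of power series.

Conversely, for `E_alt` the map `τ` sends `x` to the distance of `β x` from the nearest even
integer, so that any even integers `c_0, c_1, …, c_N`, with `c_0` large and the others somewhat
smaller, are the signed digits of a root `β ≈ c_0` of `q_{N+1}`. By Eisenstein's criterion at `2`
the other roots of `q_{N+1}` are conjugates of `β`. They are the roots of the quotient by `X - β`,
a monic polynomial with coefficients `q_{n+1}(β) ≈ c_{n+1} / β`, which can be made to approximate
any numbers in `[-1,1]`. So `Φ(E_alt)` contains the roots of all monic polynomials with coefficients
in `[-1,1]`, and these are dense in `clos 𝔻 ∪ 𝓖⁻¹`.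
-/

namespace GenBeta

section PowerSeriesEvaluation

variable {R : Type*} [NormedCommRing R] {F G : PowerSeries R} {z : R}

/-- Absolute convergence of the power series `F` at `z`. -/
def AbsSummableAt (F : PowerSeries R) (z : R) : Prop :=
  Summable fun n => ‖PowerSeries.coeff n F * z ^ n‖

/-- The value at `z` of the function defined by the power series `F`; it is meaningful only where
`F` converges. -/
noncomputable def evalSeries (F : PowerSeries R) (z : R) : R :=
  ∑' n, PowerSeries.coeff n F * z ^ n

theorem coeff_mul_mul_pow (F G : PowerSeries R) (z : R) (n : ℕ) :
    PowerSeries.coeff n (F * G) * z ^ n = ∑ kl ∈ Finset.HasAntidiagonal.antidiagonal n,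
      PowerSeries.coeff kl.1 F * z ^ kl.1 * (PowerSeries.coeff kl.2 G * z ^ kl.2) := by
  rw [PowerSeries.coeff_mul, Finset.sum_mul]
  refine Finset.sum_congr rfl fun kl hkl => ?_
  rw [← Finset.HasAntidiagonal.mem_antidiagonal.mp hkl, pow_add]
  ring

theorem AbsSummableAt.mul (hF : AbsSummableAt F z) (hG : AbsSummableAt G z) :
    AbsSummableAt (F * G) z := by
  simpa only [AbsSummableAt, coeff_mul_mul_pow] using
    summable_norm_sum_mul_antidiagonal_of_summable_norm hF hG

theorem AbsSummableAt.of_norm_coeff_le [NormOneClass R] {C : ℝ}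
    (hF : ∀ n, ‖PowerSeries.coeff n F‖ ≤ C) (hz : ‖z‖ < 1) : AbsSummableAt F z := by
  refine Summable.of_nonneg_of_le (fun _ => norm_nonneg _) (fun n => ?_)
    ((summable_geometric_of_lt_one (norm_nonneg z) hz).mul_left C)
  calc ‖PowerSeries.coeff n F * z ^ n‖ ≤ ‖PowerSeries.coeff n F‖ * ‖z ^ n‖ := norm_mul_le _ _
    _ ≤ C * ‖z‖ ^ n := by
      gcongr
      exacts [(norm_nonneg _).trans (hF 0), hF n, norm_pow_le z n]

theorem coeff_coe_mul_pow_eq_zero (P : Polynomial R) (z : R) {n : ℕ}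
    (hn : n ∉ Finset.range (P.natDegree + 1)) :
    PowerSeries.coeff n (P : PowerSeries R) * z ^ n = 0 := by
  rw [Polynomial.coeff_coe, Polynomial.coeff_eq_zero_of_natDegree_lt (by simpa using hn), zero_mul]

theorem absSummableAt_coe (P : Polynomial R) (z : R) : AbsSummableAt (P : PowerSeries R) z :=
  summable_of_ne_finset_zero fun n hn => by rw [coeff_coe_mul_pow_eq_zero P z hn, norm_zero]

theorem evalSeries_coe (P : Polynomial R) (z : R) :
    evalSeries (P : PowerSeries R) z = P.eval z := by
  rw [evalSeries, tsum_eq_sum fun n hn => coeff_coe_mul_pow_eq_zero P z hn,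
    Polynomial.eval_eq_sum_range]
  simp only [Polynomial.coeff_coe]

variable [CompleteSpace R]

theorem AbsSummableAt.hasSum (hF : AbsSummableAt F z) :
    HasSum (fun n => PowerSeries.coeff n F * z ^ n) (evalSeries F z) :=
  (Summable.of_norm hF).hasSum

theorem evalSeries_mul (hF : AbsSummableAt F z) (hG : AbsSummableAt G z) :
    evalSeries (F * G) z = evalSeries F z * evalSeries G z := by
  simp only [evalSeries, coeff_mul_mul_pow,
    tsum_mul_tsum_eq_tsum_sum_antidiagonal_of_summable_norm hF hG]

end PowerSeriesEvaluation

theorem isZeroOf_of_evalSeries_eq_zero {F : PowerSeries ℂ} {z : ℂ} (hF : AbsSummableAt F z)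
    (h : evalSeries F z = 0) : IsZeroOf F z :=
  Or.inl (h ▸ hF.hasSum)

theorem evalSeries_eq_zero_of_isZeroOf_mul {D : Polynomial ℂ} {G : PowerSeries ℂ} {z : ℂ}
    (hD : D.eval z ≠ 0) (hG : AbsSummableAt G z) (hz : IsZeroOf ((D : PowerSeries ℂ) * G) z) :
    evalSeries G z = 0 := by
  have hDG : AbsSummableAt ((D : PowerSeries ℂ) * G) z := (absSummableAt_coe D z).mul hG
  have heval : evalSeries ((D : PowerSeries ℂ) * G) z = D.eval z * evalSeries G z := by
    rw [evalSeries_mul (absSummableAt_coe D z) hG, evalSeries_coe]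
  suffices evalSeries ((D : PowerSeries ℂ) * G) z = 0 from
    (mul_eq_zero.mp (heval ▸ this)).resolve_left hD
  rcases hz with hsum | ⟨P, Q, hPQ, hQ, hP⟩
  · exact hDG.hasSum.unique hsum
  · have hQz : Q.eval z ≠ 0 := by
      have hcop : IsCoprime (P.eval z) (Q.eval z) := hPQ.map (Polynomial.evalRingHom z)
      rw [hP, isCoprime_zero_left] at hcop
      exact hcop.ne_zero
    have hprod := evalSeries_mul (absSummableAt_coe Q z) hDG
    rw [hQ, evalSeries_coe, evalSeries_coe, hP] at hprod
    exact (mul_eq_zero.mp hprod.symm).resolve_left hQz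

section Horner

open Polynomial

variable {R A B : Type*} [CommRing R] [CommRing A] [Algebra R A] [CommRing B] [Algebra R B]
  [Algebra A B] [IsScalarTower R A B]

/-- The monic polynomials `X ^ n - c 0 * X ^ (n - 1) - ⋯ - c (n - 1)` of Horner's scheme. With the
signed digits `s_n d_n` of a base `β` for `c`, the value at `β` is the signed orbit `s_n τ^n(1)`. -/
noncomputable def horner (c : ℕ → R) : ℕ → R[X]
  | 0 => 1
  | n + 1 => X * horner c n - C (c n)

theorem aeval_horner_zero (c : ℕ → R) (x : A) : aeval x (horner c 0) = 1 := map_one _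

theorem aeval_horner_succ (c : ℕ → R) (x : A) (n : ℕ) :
    aeval x (horner c (n + 1)) = x * aeval x (horner c n) - algebraMap R A (c n) := by
  simp [horner]

theorem horner_monic (c : ℕ → R) (n : ℕ) : (horner c n).Monic := by
  nontriviality R
  induction n with
  | zero => exact monic_one
  | succ n ih =>
    refine (monic_X.mul ih).sub_of_left (degree_C_le.trans_lt ?_)
    rw [← natDegree_pos_iff_degree_pos, natDegree_X_mul ih.ne_zero]
    exact Nat.succ_pos _

theorem coeff_horner_of_lt (c : ℕ → R) {i n : ℕ} (hi : i < n) :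
    (horner c n).coeff i = -c (n - 1 - i) := by
  induction n generalizing i with
  | zero => omega
  | succ n ih =>
    cases i with
    | zero => simp [horner]
    | succ i =>
      simp [horner, ih (Nat.lt_of_succ_lt_succ hi), Nat.sub_add_eq, Nat.sub_right_comm]

theorem natDegree_horner [Nontrivial R] (c : ℕ → R) (n : ℕ) : (horner c n).natDegree = n := by
  induction n with
  | zero => simp [horner]
  | succ n ih =>
    rw [horner, natDegree_sub_C, natDegree_X_mul (horner_monic c n).ne_zero, ih]

theorem coeff_horner_self (c : ℕ → R) (n : ℕ) : (horner c n).coeff n = 1 := by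
  nontriviality R
  have h := (horner_monic c n).coeff_natDegree
  rwa [natDegree_horner] at h

theorem abs_coeff_horner_le {c : ℕ → ℝ} (hc : ∀ n, |c n| ≤ 1) (N i : ℕ) :
    |(horner c N).coeff i| ≤ 1 := by
  rcases lt_trichotomy i N with hi | rfl | hi
  · rw [coeff_horner_of_lt c hi, abs_neg]
    exact hc _
  · rw [coeff_horner_self, abs_one]
  · simp [coeff_eq_zero_of_natDegree_lt ((natDegree_horner c N).trans_lt hi)]

/-- Synthetic division by `X - b`. -/
theorem aeval_horner_succ_eq_sub_mul_add (c : ℕ → R) (b : A) (w : B) (n : ℕ) :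
    aeval w (horner c (n + 1)) =
      (w - algebraMap A B b) * aeval w (horner (fun i => -aeval b (horner c (i + 1))) n) +
        algebraMap A B (aeval b (horner c (n + 1))) := by
  induction n with
  | zero =>
    simp [aeval_horner_succ, aeval_horner_zero, ← IsScalarTower.algebraMap_apply]
  | succ n ih =>
    rw [aeval_horner_succ c w, ih, aeval_horner_succ (fun i => -aeval b (horner c (i + 1))),
      aeval_horner_succ c b (n + 1), map_neg, map_sub, map_mul, ← IsScalarTower.algebraMap_apply]
    ring

theorem aeval_horner_eq_pow_mul {K : Type*} [Field K] [Algebra R K] (c : ℕ → R) {x : K}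
    (hx : x ≠ 0) (n : ℕ) :
    aeval x (horner c n) =
      x ^ n * (1 - ∑ i ∈ Finset.range n, algebraMap R K (c i) * x⁻¹ ^ (i + 1)) := by
  induction n with
  | zero => simp [aeval_horner_zero]
  | succ n ih =>
    rw [aeval_horner_succ, ih, Finset.sum_range_succ, inv_pow]
    field_simp
    ring

theorem one_sub_X_mul_mk (c : ℕ → R) (x : A) :
    1 - PowerSeries.X * PowerSeries.mk (fun n => algebraMap R A (c n)) =
      ((1 - C x * X : A[X]) : PowerSeries A) *
        PowerSeries.mk fun n => aeval x (horner c n) := by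
  rw [coe_sub, coe_mul, coe_C, coe_X, coe_one, sub_mul, one_mul, mul_assoc]
  ext n
  cases n with
  | zero => simp [aeval_horner_zero]
  | succ n => simp [PowerSeries.coeff_one, PowerSeries.coeff_succ_X_mul, aeval_horner_succ]

theorem horner_irreducible [IsDomain R] {P : Ideal R} (hP : P.IsPrime) {c : ℕ → R} {N : ℕ}
    (hc : ∀ n, c n ∈ P) (hN : c N ∉ P ^ 2) : Irreducible (horner c (N + 1)) := by
  have hm := horner_monic c (N + 1)
  have hd : (horner c (N + 1)).degree = (N + 1 : ℕ) := by
    rw [degree_eq_natDegree hm.ne_zero, natDegree_horner]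
  refine irreducible_of_eisenstein_criterion hP ?_ (fun i hi => ?_) ?_ ?_ hm.isPrimitive
  · rw [hm.leadingCoeff]
    exact hP.one_notMem
  · rw [coeff_horner_of_lt c (by rw [hd] at hi; exact_mod_cast hi)]
    exact P.neg_mem (hc _)
  · rw [hd]
    exact_mod_cast N.succ_pos
  · rw [coeff_horner_of_lt c N.succ_pos]
    simpa using hN

end Horner

/-- The signed orbit `s_n τ^n(1)`, which obeys the recursion `x_{n+1} = β x_n - s_n d_n`. -/
noncomputable def signedOrbit (β : ℝ) (E : ℕ → Fin 2) (n : ℕ) : ℝ := cumSgn β E n * orbit β E n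

section Orbit

variable (β : ℝ) (E : ℕ → Fin 2) (n : ℕ)

theorem orbit_succ : orbit β E (n + 1) = tau β E (orbit β E n) :=
  Function.iterate_succ_apply' ..

theorem orbit_mem_Icc : orbit β E n ∈ Set.Icc (0 : ℝ) 1 := by
  cases n with
  | zero => simp [orbit]
  | succ n => exact orbit_succ β E n ▸ tau_mem_Icc ..

theorem cumSgn_succ : cumSgn β E (n + 1) = cumSgn β E n * sgn β E n :=
  Finset.prod_range_succ ..

theorem cumSgn_eq_one_or : cumSgn β E n = 1 ∨ cumSgn β E n = -1 := by
  refine Int.isUnit_iff.mp ((Finset.range n).prod_induction _ IsUnit (fun _ _ => IsUnit.mul)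
    isUnit_one fun i _ => ?_)
  exact (isUnit_one.neg).pow _

theorem signedOrbit_zero : signedOrbit β E 0 = 1 := by
  simp [signedOrbit, cumSgn, orbit]

theorem abs_signedOrbit : |signedOrbit β E n| = orbit β E n := by
  have h := (orbit_mem_Icc β E n).1
  rcases cumSgn_eq_one_or β E n with hs | hs <;> simp [signedOrbit, hs, abs_of_nonneg h]

variable {β}

theorem signedOrbit_succ (hβ : 0 ≤ β) :
    signedOrbit β E (n + 1) = β * signedOrbit β E n - cumSgn β E n * digit β E n := by
  have hbranch : (branch β (orbit β E n) : ℝ) = β * orbit β E n - Int.fract (β * orbit β E n) :=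
    (natCast_floor_eq_intCast_floor (mul_nonneg hβ (orbit_mem_Icc β E n).1)).trans
      (Int.self_sub_fract _).symm
  simp only [signedOrbit, cumSgn_succ, orbit_succ, tau, sgn, digit]
  push_cast
  rw [hbranch]
  generalize Int.fract (β * orbit β E n) = t
  generalize E (branch β (orbit β E n)) = e
  fin_cases e <;> simp <;> ring

theorem natCast_branch_of_mem_EP (hβ : β ≠ 0) {x : ℝ} (hx : x ∈ EP β) :
    (branch β x : ℝ) = β * x := by
  obtain ⟨k, -, -, rfl⟩ := hx
  rw [branch, mul_div_cancel₀ _ hβ, Nat.floor_natCast]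

variable {E}

theorem orbit_firstHit_mem_EP (h : IsSimple β E) : orbit β E (firstHit β E) ∈ EP β :=
  (Nat.sInf_mem (s := {n : ℕ | 1 ≤ n ∧ orbit β E n ∈ EP β}) h.2).2

end Orbit

section Phi

open Polynomial

open Classical in
/-- The coefficient of `X ^ (n + 1)` in `φ_{β,E}`. In the simple case it is an integer even at the
last index `N`, where `τ^N(1) = k / β` makes `β τ^N(1)` the branch number `k`. -/
noncomputable def phiDigit (β : ℝ) (E : ℕ → Fin 2) (n : ℕ) : ℤ :=
  if IsSimple β E ∧ firstHit β E ≤ n then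
    if n = firstHit β E then cumSgn β E n * branch β (orbit β E n) else 0
  else cumSgn β E n * digit β E n

variable {β : ℝ} {E : ℕ → Fin 2}

theorem phi_eq (hβ : β ≠ 0) :
    phi β E = PowerSeries.X * PowerSeries.mk fun n => (phiDigit β E n : ℂ) := by
  by_cases h : IsSimple β E
  · have hlast : (branch β (orbit β E (firstHit β E)) : ℝ) = β * orbit β E (firstHit β E) :=
      natCast_branch_of_mem_EP hβ (orbit_firstHit_mem_EP h)
    ext n
    cases n with
    | zero => simp [phi, h]
    | succ n =>
      simp only [phi, h, if_true, map_add, map_sum, PowerSeries.coeff_C_mul_X_pow,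
        PowerSeries.coeff_succ_X_mul, PowerSeries.coeff_mk, phiDigit, add_left_inj,
        Finset.sum_ite_eq, Finset.mem_range, true_and]
      rcases lt_trichotomy n (firstHit β E) with hn | rfl | hn
      · simp [hn, hn.ne, hn.not_ge]
      · simp [← hlast, mul_comm]
      · simp [hn.le, hn.not_gt, hn.ne']
  · simp [phi, phiDigit, h]

theorem one_sub_phi_eq (hβ : β ≠ 0) (x : ℂ) :
    1 - phi β E = ((1 - C x * X : ℂ[X]) : PowerSeries ℂ) *
      PowerSeries.mk fun n => aeval x (horner (phiDigit β E) n) := by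
  rw [phi_eq hβ]
  exact one_sub_X_mul_mk (phiDigit β E) x

open Classical in
theorem aeval_horner_phiDigit (hβ : 0 < β) (n : ℕ) :
    aeval β (horner (phiDigit β E) n) =
      if IsSimple β E ∧ firstHit β E < n then 0 else signedOrbit β E n := by
  induction n with
  | zero => simp [aeval_horner_zero, signedOrbit_zero]
  | succ n ih =>
    rw [aeval_horner_succ, ih, phiDigit, algebraMap_int_eq, eq_intCast]
    simp only [Nat.lt_succ_iff]
    by_cases h : IsSimple β E ∧ firstHit β E ≤ n
    · rw [if_pos h, if_pos h]
      rcases h.2.eq_or_lt with hn | hn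
      · have hbranch := natCast_branch_of_mem_EP hβ.ne' (orbit_firstHit_mem_EP h.1)
        rw [hn] at hbranch
        simp only [hn, lt_irrefl, and_false, if_false, if_true, signedOrbit]
        push_cast
        rw [hbranch]
        ring
      · simp [h.1, hn, hn.ne']
    · rw [if_neg h, if_neg h, if_neg fun h' => h ⟨h'.1, h'.2.le⟩, signedOrbit_succ E n hβ.le]
      push_cast
      rfl

theorem abs_aeval_horner_phiDigit_le_one (hβ : 0 < β) (n : ℕ) :
    |aeval β (horner (phiDigit β E) n)| ≤ 1 := by
  rw [aeval_horner_phiDigit hβ]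
  split_ifs
  · simp
  · exact abs_signedOrbit β E n ▸ (orbit_mem_Icc β E n).2

theorem isZeroOf_inv_of_absSummableAt (hβ : β ≠ 0) {z : ℂ} (hz : z ≠ 0)
    (hs : AbsSummableAt (PowerSeries.mk fun n => aeval z (horner (phiDigit β E) n)) z⁻¹) :
    IsZeroOf (1 - phi β E) z⁻¹ := by
  rw [one_sub_phi_eq hβ z]
  refine isZeroOf_of_evalSeries_eq_zero ((absSummableAt_coe _ _).mul hs) ?_
  rw [evalSeries_mul (absSummableAt_coe _ _) hs, evalSeries_coe]
  simp [mul_inv_cancel₀ hz]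

end Phi

section PowerSeriesZeros

variable {I : Set ℝ}

/-- The coefficient sequences of the members of `𝓕_I`, as a set in the product space `ℕ → ℝ`. -/
def coeffSeq (I : Set ℝ) : Set (ℕ → ℝ) :=
  Set.univ.pi fun n => if n = 0 then {1} else I

theorem mem_coeffSeq {a : ℕ → ℝ} : a ∈ coeffSeq I ↔ a 0 = 1 ∧ ∀ n, 1 ≤ n → a n ∈ I := by
  refine ⟨fun ha => ⟨by simpa using ha 0 trivial, fun n hn => ?_⟩, fun ha n _ => ?_⟩
  · simpa [Nat.one_le_iff_ne_zero.mp hn] using ha n trivial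
  · rcases eq_or_ne n 0 with rfl | hn
    · simpa using ha.1
    · simpa [hn] using ha.2 n (Nat.one_le_iff_ne_zero.mpr hn)

theorem isCompact_coeffSeq (hI : IsCompact I) : IsCompact (coeffSeq I) :=
  isCompact_univ_pi fun n => by split_ifs <;> [exact isCompact_singleton; exact hI]

theorem exists_abs_le_of_mem_coeffSeq (hI : Bornology.IsBounded I) :
    ∃ C, ∀ a ∈ coeffSeq I, ∀ n, |a n| ≤ C := by
  obtain ⟨C, hC⟩ := (hI.insert 1).exists_norm_le
  refine ⟨C, fun a ha n => hC _ ?_⟩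
  rcases Nat.eq_zero_or_pos n with rfl | hn
  · exact Or.inl (mem_coeffSeq.mp ha).1
  · exact Or.inr ((mem_coeffSeq.mp ha).2 n hn)

theorem mem_GG_iff (hI : Bornology.IsBounded I) {z : ℂ} :
    z ∈ GG I ↔ ‖z‖ < 1 ∧ ∃ a ∈ coeffSeq I, ∑' n, (a n : ℂ) * z ^ n = 0 := by
  refine ⟨fun ⟨hz, f, hf, hsum⟩ => ⟨by simpa using hz, fun n => PowerSeries.coeff n f,
    mem_coeffSeq.mpr hf, hsum.tsum_eq⟩, fun ⟨hz, a, ha, hsum⟩ => ⟨by simpa using hz,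
    PowerSeries.mk a, ?_, ?_⟩⟩
  · simpa only [FF, Set.mem_ofPred_eq, PowerSeries.coeff_mk] using mem_coeffSeq.mp ha
  · obtain ⟨C, hC⟩ := exists_abs_le_of_mem_coeffSeq hI
    have hs : AbsSummableAt (PowerSeries.mk fun n => (a n : ℂ)) z :=
      .of_norm_coeff_le (C := C) (fun n => by simpa using hC a ha n) hz
    simpa only [evalSeries, PowerSeries.coeff_mk, hsum] using hs.hasSum

theorem continuousOn_tsum_coeff_mul_pow {S : Set (ℕ → ℝ)} {C r : ℝ} (hr : r < 1)
    (hS : ∀ a ∈ S, ∀ n, |a n| ≤ C) :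
    ContinuousOn (fun p : (ℕ → ℝ) × ℂ => ∑' n, (p.1 n : ℂ) * p.2 ^ n)
      (S ×ˢ Metric.closedBall 0 r) := by
  rcases lt_or_ge r 0 with hr0 | hr0
  · simp [Metric.closedBall_eq_empty.mpr hr0]
  refine continuousOn_tsum (u := fun n => C * r ^ n) (fun n => by fun_prop)
    ((summable_geometric_of_lt_one hr0 hr).mul_left C) fun n p hp => ?_
  have ha : |p.1 n| ≤ C := hS _ hp.1 n
  have hz : ‖p.2‖ ≤ r := mem_closedBall_zero_iff.mp hp.2
  rw [norm_mul, norm_pow, Complex.norm_real, Real.norm_eq_abs]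
  exact mul_le_mul ha (pow_le_pow_left₀ (norm_nonneg _) hz n) (by positivity)
    ((abs_nonneg _).trans ha)

theorem isCompact_GG_inter_closedBall (hI : IsCompact I) {r : ℝ} (hr : r < 1) :
    IsCompact (GG I ∩ Metric.closedBall 0 r) := by
  obtain ⟨C, hC⟩ := exists_abs_le_of_mem_coeffSeq hI.isBounded
  have hK := (isCompact_coeffSeq hI).prod (isCompact_closedBall (0 : ℂ) r)
  have hclosed := (continuousOn_tsum_coeff_mul_pow hr hC).preimage_isClosed_of_isClosed
    hK.isClosed (isClosed_singleton (x := 0))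
  have hzeros := hK.of_isClosed_subset hclosed Set.inter_subset_left
  convert hzeros.image continuous_snd using 1
  ext z
  rw [Set.mem_inter_iff, mem_GG_iff hI.isBounded]
  constructor
  · rintro ⟨⟨-, a, ha, hsum⟩, hz⟩
    exact ⟨(a, z), ⟨⟨ha, hz⟩, hsum⟩, rfl⟩
  · rintro ⟨⟨a, w⟩, ⟨⟨ha, hw⟩, hsum⟩, rfl⟩
    exact ⟨⟨(mem_closedBall_zero_iff.mp hw).trans_lt hr, a, ha, hsum⟩, hw⟩

theorem mem_closure_ball_one {w : ℂ} : w ∈ closure (Metric.ball (0 : ℂ) 1) ↔ ‖w‖ ≤ 1 := by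
  rw [closure_ball _ one_ne_zero, mem_closedBall_zero_iff]

theorem isClosed_closure_ball_union_invSet_GG (hI : IsCompact I) :
    IsClosed (closure (Metric.ball (0 : ℂ) 1) ∪ invSet (GG I)) := by
  rw [← closure_subset_iff_isClosed, closure_union, closure_closure]
  rintro w (hw | hw)
  · exact Or.inl hw
  rcases le_or_gt ‖w‖ 1 with hw1 | hw1
  · exact Or.inl (mem_closure_ball_one.mpr hw1)
  have hw0 : w ≠ 0 := norm_pos_iff.mp (one_pos.trans hw1)
  have hmem : w⁻¹ ∈ closure (GG I) := by
    simpa [invSet, Set.image_image] using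
      mem_closure_image (f := fun z : ℂ => z⁻¹) (continuousAt_inv₀ hw0) hw
  obtain ⟨r, hwr, hr⟩ := exists_between (norm_inv w ▸ inv_lt_one_of_one_lt₀ hw1)
  have hmem_ball : w⁻¹ ∈ closure (GG I ∩ Metric.closedBall 0 r) := by
    rw [Set.inter_comm]
    exact closure_mono (Set.inter_subset_inter_left _ Metric.ball_subset_closedBall)
      (Metric.isOpen_ball.inter_closure ⟨by simpa using hwr, hmem⟩)
  rw [(isCompact_GG_inter_closedBall hI hr).isClosed.closure_eq] at hmem_ball
  exact Or.inr ⟨w⁻¹, hmem_ball.1, inv_inv w⟩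

end PowerSeriesZeros

/-- The set `clos 𝔻 ∪ 𝓖_{[-1,1]}⁻¹`, with which all the sets of conjugates and zeros are
compared. -/
def conjRegion : Set ℂ := closure (Metric.ball (0 : ℂ) 1) ∪ invSet (GG (Set.Icc (-1 : ℝ) 1))

theorem isClosed_conjRegion : IsClosed conjRegion :=
  isClosed_closure_ball_union_invSet_GG isCompact_Icc

theorem mem_conjRegion_of_norm_le_one {z : ℂ} (hz : ‖z‖ ≤ 1) : z ∈ conjRegion :=
  Or.inl (mem_closure_ball_one.mpr hz)

section UpperInclusion

open Polynomial

variable {β : ℝ} {E : ℕ → Fin 2} {z : ℂ}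

theorem inv_mem_conjRegion_of_isZeroOf (hβ : 0 < β) (hz : IsZeroOf (1 - phi β E) z)
    (hne : z ≠ (β : ℂ)⁻¹) : z⁻¹ ∈ conjRegion := by
  rcases le_or_gt 1 ‖z‖ with hz1 | hz1
  · exact mem_conjRegion_of_norm_le_one (norm_inv z ▸ inv_le_one_of_one_le₀ hz1)
  set x : ℕ → ℝ := fun n => aeval β (horner (phiDigit β E) n)
  have hx : ∀ n, |x n| ≤ 1 := abs_aeval_horner_phiDigit_le_one hβ
  have hcast : (fun n => aeval (β : ℂ) (horner (phiDigit β E) n)) = fun n => (x n : ℂ) :=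
    funext fun n => aeval_algebraMap_apply ℂ β _
  have hs : AbsSummableAt (PowerSeries.mk fun n => (x n : ℂ)) z :=
    .of_norm_coeff_le (C := 1) (fun n => by simpa using hx n) hz1
  have hfactor : (1 - C (β : ℂ) * X : ℂ[X]).eval z ≠ 0 := fun h =>
    hne (eq_inv_of_mul_eq_one_right (sub_eq_zero.mp (by simpa using h)).symm)
  have hzero : evalSeries (PowerSeries.mk fun n => (x n : ℂ)) z = 0 :=
    evalSeries_eq_zero_of_isZeroOf_mul hfactor hs (hcast ▸ one_sub_phi_eq hβ.ne' (β : ℂ) ▸ hz)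
  refine Or.inr ⟨z, (mem_GG_iff isCompact_Icc.isBounded).mpr ⟨hz1, x, ?_, ?_⟩, rfl⟩
  · exact mem_coeffSeq.mpr ⟨aeval_horner_zero _ _, fun n _ => abs_le.mp (hx n)⟩
  · simpa only [evalSeries, PowerSeries.coeff_mk] using hzero

theorem aeval_eq_zero_of_mem_galoisConjugates (hz : z ∈ galoisConjugates β) {p : ℤ[X]}
    (hp : aeval β p = 0) : aeval z p = 0 := by
  have hpβ : aeval (β : ℂ) (p.map (algebraMap ℤ ℚ)) = 0 := by
    rw [aeval_map_algebraMap, ← Complex.coe_algebraMap, aeval_algebraMap_apply, hp, map_zero]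
  rw [← aeval_map_algebraMap ℚ]
  exact aeval_eq_zero_of_dvd_aeval_eq_zero (hz.2.1 ▸ minpoly.dvd ℚ _ hpβ) (minpoly.aeval ℚ z)

theorem ne_zero_of_mem_galoisConjugates (hβ : β ≠ 0) (hz : z ∈ galoisConjugates β) : z ≠ 0 :=
  hz.2.1.ne_zero (Complex.ofReal_ne_zero.mpr hβ)

theorem inv_ne_inv_of_mem_galoisConjugates (hz : z ∈ galoisConjugates β) : z⁻¹ ≠ (β : ℂ)⁻¹ :=
  fun h => hz.2.2 (inv_injective h)

theorem finite_range_aeval_of_mem_galoisConjugates (hz : z ∈ galoisConjugates β) {p : ℕ → ℤ[X]}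
    (h : (Set.range fun n => aeval β (p n)).Finite) :
    (Set.range fun n => aeval z (p n)).Finite := by
  have hfactors : Function.FactorsThrough (fun n => aeval z (p n)) fun n => aeval β (p n) := by
    intro m n hmn
    rw [← sub_eq_zero, ← map_sub]
    exact aeval_eq_zero_of_mem_galoisConjugates hz (by rw [map_sub, sub_eq_zero]; exact hmn)
  rw [← hfactors.extend_comp (fun _ => 0), Set.range_comp]
  exact h.image _

theorem IsGenParry.finite_range_aeval_horner (h : IsGenParry β E) :
    (Set.range fun n => aeval β (horner (phiDigit β E) n)).Finite := by
  refine ((h.2.union (h.2.image Neg.neg)).insert 0).subset ?_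
  rintro _ ⟨n, rfl⟩
  simp only [aeval_horner_phiDigit (one_pos.trans h.1.1)]
  split_ifs
  · exact Or.inl rfl
  · rcases cumSgn_eq_one_or β E n with hs | hs
    · exact Or.inr (Or.inl ⟨n, by simp [signedOrbit, hs]⟩)
    · exact Or.inr (Or.inr ⟨_, ⟨n, rfl⟩, by simp [signedOrbit, hs]⟩)

theorem IsGenParry.isZeroOf_inv (h : IsGenParry β E) (hz : z ∈ galoisConjugates β)
    (hz1 : 1 < ‖z‖) : IsZeroOf (1 - phi β E) z⁻¹ := by
  obtain ⟨C, hC⟩ := (finite_range_aeval_of_mem_galoisConjugates hz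
    h.finite_range_aeval_horner).isBounded.exists_norm_le
  have hβ : β ≠ 0 := (one_pos.trans h.1.1).ne'
  refine isZeroOf_inv_of_absSummableAt hβ (ne_zero_of_mem_galoisConjugates hβ hz)
    (.of_norm_coeff_le (C := C) (fun n => ?_) (norm_inv z ▸ inv_lt_one_of_one_lt₀ hz1))
  rw [PowerSeries.coeff_mk]
  exact hC _ ⟨n, rfl⟩

theorem IsSimple.isZeroOf_inv (h : IsSimple β E) (hz : z ∈ galoisConjugates β) :
    IsZeroOf (1 - phi β E) z⁻¹ := by
  have hβ : 0 < β := one_pos.trans h.1.1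
  refine isZeroOf_inv_of_absSummableAt hβ.ne' (ne_zero_of_mem_galoisConjugates hβ.ne' hz)
    (summable_of_ne_finset_zero (s := Finset.range (firstHit β E + 1)) fun n hn => ?_)
  have hn : firstHit β E < n := by simpa using hn
  have hzero : aeval β (horner (phiDigit β E) n) = 0 := by
    rw [aeval_horner_phiDigit hβ, if_pos ⟨h, hn⟩]
  rw [PowerSeries.coeff_mk, aeval_eq_zero_of_mem_galoisConjugates hz hzero, zero_mul, norm_zero]

theorem tau_of_fract_eq_zero {x : ℝ} (hx : Int.fract (β * x) = 0) :
    tau β E x = 0 ∨ tau β E x = 1 := by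
  rw [tau, hx, mul_zero, add_zero]
  generalize E _ = e
  fin_cases e <;> simp

theorem fract_mul_of_mem_EP (hβ : β ≠ 0) {x : ℝ} (hx : x ∈ EP β) : Int.fract (β * x) = 0 := by
  obtain ⟨k, -, -, rfl⟩ := hx
  rw [mul_div_cancel₀ _ hβ, Int.fract_natCast]

theorem IsSimple.isGenParry (h : IsSimple β E) : IsGenParry β E := by
  obtain ⟨hβ, N, -, hN⟩ := h
  set S : Set ℝ := insert 0 (orbit β E '' Set.Iic N)
  have one_mem : (1 : ℝ) ∈ S := Or.inr ⟨0, N.zero_le, rfl⟩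
  have tau_mem {x : ℝ} (hx : Int.fract (β * x) = 0) : tau β E x ∈ S := by
    rcases tau_of_fract_eq_zero (E := E) hx with h0 | h1
    · exact Or.inl h0
    · exact h1 ▸ one_mem
  have hmaps : Set.MapsTo (tau β E) S S := by
    rintro _ (rfl | ⟨i, hi, rfl⟩)
    · exact tau_mem (by simp)
    · rcases (Set.mem_Iic.mp hi).lt_or_eq with hlt | rfl
      · exact Or.inr ⟨i + 1, hlt, orbit_succ β E i⟩
      · exact tau_mem (fract_mul_of_mem_EP (one_pos.trans hβ.1).ne' hN)
  have hfinite : S.Finite := ((Set.finite_Iic N).image _).insert 0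
  refine ⟨hβ, hfinite.subset ?_⟩
  rintro _ ⟨n, rfl⟩
  exact hmaps.iterate n one_mem

theorem Phi_subset_PhiHat (E : ℕ → Fin 2) : Phi E ⊆ PhiHat E :=
  closure_mono fun _ ⟨β, hβ, hz⟩ => ⟨β, hβ.isGenParry, hz⟩

theorem Phi_subset_PhiStar (E : ℕ → Fin 2) : Phi E ⊆ PhiStar E :=
  closure_mono fun z ⟨β, hβ, hz⟩ => ⟨β, hβ.1, z⁻¹, hβ.isZeroOf_inv hz,
    inv_ne_inv_of_mem_galoisConjugates hz, (inv_inv z).symm⟩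

theorem PhiStar_subset_conjRegion (E : ℕ → Fin 2) : PhiStar E ⊆ conjRegion :=
  closure_minimal (fun _ ⟨_, hβ, _, hz, hne, hw⟩ =>
    hw ▸ inv_mem_conjRegion_of_isZeroOf (one_pos.trans hβ.1) hz hne) isClosed_conjRegion

theorem PhiHat_subset_conjRegion (E : ℕ → Fin 2) : PhiHat E ⊆ conjRegion := by
  refine closure_minimal (fun z ⟨β, hβ, hz⟩ => ?_) isClosed_conjRegion
  rcases le_or_gt ‖z‖ 1 with hz1 | hz1
  · exact mem_conjRegion_of_norm_le_one hz1
  · exact inv_inv z ▸ inv_mem_conjRegion_of_isZeroOf (one_pos.trans hβ.1.1)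
      (hβ.isZeroOf_inv hz hz1) (inv_ne_inv_of_mem_galoisConjugates hz)

end UpperInclusion

section Shadowing

open Polynomial

variable {β : ℝ} {c : ℕ → ℤ} {N : ℕ}

/-- For `E_alt`, the map `τ` measures the distance of `β x` from the even integers; up to signs it
is therefore `u ↦ β u - 2 m`. -/
theorem tau_Ealt_abs {u : ℝ} (hβ : 0 ≤ β) (m : ℤ) (h : |β * u - 2 * m| < 1) :
    tau β Ealt |u| = |β * u - 2 * m| := by
  wlog hu : 0 ≤ u generalizing u m
  · have hneg : β * -u - 2 * ((-m : ℤ) : ℝ) = -(β * u - 2 * m) := by push_cast; ring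
    have := this (u := -u) (-m) (by rwa [hneg, abs_neg]) (by linarith)
    rwa [hneg, abs_neg, abs_neg] at this
  rw [abs_of_nonneg hu]
  have hbranch : (branch β u : ℤ) = ⌊β * u⌋ := Int.natCast_floor_eq_floor (mul_nonneg hβ hu)
  obtain ⟨hlo, hhi⟩ := abs_lt.mp h
  rcases le_or_gt 0 (β * u - 2 * m) with h0 | h0
  · have hfloor : ⌊β * u⌋ = 2 * m := by
      rw [Int.floor_eq_iff]; push_cast; constructor <;> linarith
    have heven : Even (branch β u) := by
      rw [← Int.even_coe_nat, hbranch, hfloor]; exact even_two_mul m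
    rw [abs_of_nonneg h0, tau]
    simp [Ealt, heven, Int.fract, hfloor]
  · have hfloor : ⌊β * u⌋ = 2 * m - 1 := by
      rw [Int.floor_eq_iff]; push_cast; constructor <;> linarith
    have hodd : ¬ Even (branch β u) := by
      rw [← Int.even_coe_nat, hbranch, hfloor, Int.not_even_iff_odd]; exact ⟨m - 1, by ring⟩
    rw [abs_of_neg h0, tau]
    simp [Ealt, hodd, Int.fract, hfloor]
    ring

theorem one_le_aeval_horner (hc : ∀ n, (c n : ℝ) ≤ β - 1) (hβ : 0 ≤ β) (n : ℕ) :
    1 ≤ aeval β (horner c n) := by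
  induction n with
  | zero => rw [aeval_horner_zero]
  | succ n ih =>
    rw [aeval_horner_succ, algebraMap_int_eq, eq_intCast]
    nlinarith [hc n]

theorem aeval_horner_succ_le_neg_one (h0 : β + 1 ≤ c 0) (hc : ∀ n, 1 ≤ n → 1 - β ≤ c n)
    (hβ : 0 ≤ β) (n : ℕ) : aeval β (horner c (n + 1)) ≤ -1 := by
  induction n with
  | zero =>
    rw [aeval_horner_succ, aeval_horner_zero, algebraMap_int_eq, eq_intCast]
    linarith
  | succ n ih =>
    rw [aeval_horner_succ, algebraMap_int_eq, eq_intCast]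
    nlinarith [hc (n + 1) (Nat.le_add_left 1 n)]

theorem exists_aeval_horner_eq_zero {L : ℝ} (h0 : c 0 = L) (hc : ∀ n, 1 ≤ n → |(c n : ℝ)| ≤ L - 2)
    (N : ℕ) : ∃ β ∈ Set.Icc (L - 1) (L + 1), aeval β (horner c (N + 1)) = 0 := by
  have hL : 2 ≤ L := sub_nonneg.mp ((abs_nonneg _).trans (hc 1 le_rfl))
  have hc_le (n : ℕ) : (c n : ℝ) ≤ L + 1 - 1 := by
    rcases Nat.eq_zero_or_pos n with rfl | hn
    · linarith
    · linarith [le_of_abs_le (hc n hn)]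
  have hlow : aeval (L - 1) (horner c (N + 1)) ≤ -1 :=
    aeval_horner_succ_le_neg_one (by linarith)
      (fun n hn => by linarith [neg_le_of_abs_le (hc n hn)]) (by linarith) N
  have hhigh : 1 ≤ aeval (L + 1) (horner c (N + 1)) := one_le_aeval_horner hc_le (by linarith) _
  exact intermediate_value_Icc (by linarith) (horner c (N + 1)).continuous_aeval.continuousOn
    ⟨by linarith, by linarith⟩

/-- Once `|q_n(β)| ≥ 1` for Horner's polynomials `q_n`, this persists; so it cannot happen before a
later `q_M` vanishes. -/
theorem abs_aeval_horner_lt_one (hc : ∀ n, 1 ≤ n → |(c n : ℝ)| ≤ β - 1) {M : ℕ}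
    (hroot : aeval β (horner c M) = 0) {n : ℕ} (hn : 1 ≤ n) (hnM : n ≤ M) :
    |aeval β (horner c n)| < 1 := by
  by_contra! hlarge
  have hpersist (m : ℕ) (hm : n ≤ m) : 1 ≤ |aeval β (horner c m)| := by
    induction m, hm using Nat.le_induction with
    | base => exact hlarge
    | succ m hm ih =>
      have hβ : 1 ≤ β := sub_nonneg.mp ((abs_nonneg _).trans (hc 1 le_rfl))
      have htri := abs_sub_abs_le_abs_sub (β * aeval β (horner c m)) (c m)
      rw [abs_mul, abs_of_nonneg (zero_le_one.trans hβ)] at htri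
      rw [aeval_horner_succ, algebraMap_int_eq, eq_intCast]
      nlinarith [hc m (hn.trans hm)]
  have := hpersist M hnM
  rw [hroot, abs_zero] at this
  exact absurd this (by norm_num)

theorem orbit_Ealt_eq_abs_aeval_horner (heven : ∀ n, Even (c n))
    (hc : ∀ n, 1 ≤ n → |(c n : ℝ)| ≤ β - 1) (hroot : aeval β (horner c (N + 1)) = 0) {n : ℕ}
    (hn : n ≤ N) : orbit β Ealt n = |aeval β (horner c n)| := by
  have hβ : 0 ≤ β := by linarith [(abs_nonneg _).trans (hc 1 le_rfl)]
  induction n with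
  | zero => simp [orbit, aeval_horner_zero]
  | succ n ih =>
    obtain ⟨m, hm⟩ := (heven n).two_dvd
    have hsucc : aeval β (horner c (n + 1)) = β * aeval β (horner c n) - 2 * m := by
      rw [aeval_horner_succ, hm, algebraMap_int_eq, eq_intCast, Int.cast_mul, Int.cast_two]
    have hlt := abs_aeval_horner_lt_one hc hroot (Nat.le_add_left 1 n) (hn.trans N.le_succ)
    rw [hsucc] at hlt
    rw [orbit_succ, ih (Nat.le_of_succ_le hn), hsucc, tau_Ealt_abs hβ m hlt]

theorem mul_aeval_horner_eq_of_root (hroot : aeval β (horner c (N + 1)) = 0) :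
    β * aeval β (horner c N) = c N := by
  rwa [aeval_horner_succ, sub_eq_zero, algebraMap_int_eq, eq_intCast] at hroot

theorem ne_intCast_of_root (hroot : aeval β (horner c (N + 1)) = 0)
    (hlt : |aeval β (horner c N)| < 1) (hcN : c N ≠ 0) (m : ℤ) : β ≠ m := by
  rintro rfl
  have hint : aeval (m : ℝ) (horner c N) = ((aeval m (horner c N) : ℤ) : ℝ) :=
    aeval_algebraMap_apply ℝ m (horner c N)
  have hzero : aeval m (horner c N) = 0 := by
    rw [hint] at hlt
    exact Int.abs_lt_one_iff.mp (by exact_mod_cast hlt)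
  have hlast := mul_aeval_horner_eq_of_root hroot
  rw [hint, hzero, Int.cast_zero, mul_zero] at hlast
  exact hcN (by exact_mod_cast hlast.symm)

theorem isSimple_Ealt_of_root (heven : ∀ n, Even (c n))
    (hc : ∀ n, 1 ≤ n → |(c n : ℝ)| ≤ β - 1) (hroot : aeval β (horner c (N + 1)) = 0)
    (hN : 1 ≤ N) (hcN : c N ≠ 0) : IsSimple β Ealt := by
  have hβ : 1 < β := by
    have : (1 : ℝ) ≤ |(c N : ℝ)| := by exact_mod_cast Int.one_le_abs hcN
    linarith [hc N hN]
  have hβ0 : 0 < β := one_pos.trans hβ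
  have hlt := abs_aeval_horner_lt_one hc hroot hN N.le_succ
  have habs : β * |aeval β (horner c N)| = ((c N).natAbs : ℝ) := by
    rw [Nat.cast_natAbs, Int.cast_abs, ← mul_aeval_horner_eq_of_root hroot, abs_mul,
      abs_of_pos hβ0]
  refine ⟨⟨hβ, ne_intCast_of_root hroot hlt hcN⟩, N, hN, (c N).natAbs, Int.natAbs_pos.mpr hcN,
    ?_, ?_⟩
  · rw [Nat.le_floor_iff hβ0.le, ← habs]
    exact mul_le_of_le_one_right hβ0.le hlt.le
  · rw [orbit_Ealt_eq_abs_aeval_horner heven hc hroot le_rfl, ← habs,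
      mul_div_cancel_left₀ _ hβ0.ne']

theorem mem_galoisConjugates_of_irreducible {p : ℤ[X]} (hp : Irreducible p) (hm : p.Monic)
    (hβ : aeval β p = 0) {w : ℂ} (hw : aeval w p = 0) (hne : w ≠ β) : w ∈ galoisConjugates β := by
  have hirr : Irreducible (p.map (algebraMap ℤ ℚ)) :=
    hm.irreducible_iff_irreducible_map_fraction_map.mp hp
  have hminpoly {x : ℂ} (hx : aeval x p = 0) : p.map (algebraMap ℤ ℚ) = minpoly ℚ x :=
    minpoly.eq_of_irreducible_of_monic hirr (by rwa [aeval_map_algebraMap]) (hm.map _)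
  have hβ' : aeval (β : ℂ) p = 0 := by
    rw [← Complex.coe_algebraMap, aeval_algebraMap_apply, hβ, map_zero]
  exact ⟨⟨_, (hm.map _).ne_zero, by rwa [aeval_map_algebraMap]⟩,
    (hminpoly hβ').symm.trans (hminpoly hw), hne⟩

theorem mem_galoisConjugates_of_aeval_horner (heven : ∀ n, Even (c n)) (hN : ¬ 4 ∣ c N)
    (hroot : aeval β (horner c (N + 1)) = 0) {w : ℂ}
    (hw : aeval w (horner (fun n => -aeval β (horner c (n + 1))) N) = 0) (hne : w ≠ β) :
    w ∈ galoisConjugates β := by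
  have hprime : (Ideal.span {(2 : ℤ)}).IsPrime :=
    (Ideal.span_singleton_prime two_ne_zero).mpr Int.prime_two
  have hirr : Irreducible (horner c (N + 1)) := by
    refine horner_irreducible hprime (fun n => ?_) ?_
    · exact Ideal.mem_span_singleton.mpr (heven n).two_dvd
    · rwa [Ideal.span_singleton_pow, Ideal.mem_span_singleton]
  refine mem_galoisConjugates_of_irreducible hirr (horner_monic c _) hroot ?_ hne
  rw [aeval_horner_succ_eq_sub_mul_add c β w, hw, hroot, mul_zero, map_zero, add_zero]

/-- Even digits `c` for which the numbers `-c (n + 1) / β` with `β` close to `2 * K` shadow `a n`;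
from the index `1` on they are odd multiples of `2`, for Eisenstein's criterion. -/
noncomputable def shadowDigit (K : ℕ) (a : ℕ → ℝ) : ℕ → ℤ
  | 0 => 2 * K
  | n + 1 => 4 * ⌊-((2 * K - 4) * a n) / 4⌋ + 2

section ShadowDigit

variable (K : ℕ) (a : ℕ → ℝ)

theorem even_shadowDigit (n : ℕ) : Even (shadowDigit K a n) := by
  cases n with
  | zero => exact even_two_mul _
  | succ n => exact ((by decide : Even (4 : ℤ)).mul_right _).add even_two

theorem not_four_dvd_shadowDigit_succ (n : ℕ) : ¬ 4 ∣ shadowDigit K a (n + 1) := by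
  rw [shadowDigit]
  omega

theorem abs_shadowDigit_succ_add_le (n : ℕ) :
    |(shadowDigit K a (n + 1) : ℝ) + (2 * K - 4) * a n| ≤ 2 := by
  have hfloor := Int.floor_le (-((2 * K - 4) * a n) / 4)
  have hlt := Int.lt_floor_add_one (-((2 * K - 4) * a n) / 4)
  rw [shadowDigit, abs_le]
  push_cast
  constructor <;> linarith

variable {K a}

theorem abs_shadowDigit_le (hK : 2 ≤ K) (ha : ∀ n, |a n| ≤ 1) {n : ℕ} (hn : 1 ≤ n) :
    |(shadowDigit K a n : ℝ)| ≤ 2 * K - 2 := by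
  obtain ⟨n, rfl⟩ := Nat.exists_eq_add_of_le' hn
  have hK' : (0 : ℝ) ≤ 2 * K - 4 := by
    have : (2 : ℝ) ≤ K := by exact_mod_cast hK
    linarith
  have hmul : |(2 * K - 4) * a n| ≤ 2 * K - 4 := by
    rw [abs_mul, abs_of_nonneg hK']
    exact mul_le_of_le_one_right hK' (ha n)
  have htri := abs_sub_abs_le_abs_add (shadowDigit K a (n + 1) : ℝ) ((2 * K - 4) * a n)
  linarith [abs_shadowDigit_succ_add_le K a n]

theorem mul_abs_neg_aeval_horner_shadowDigit_sub_lt (hK : 2 ≤ K) (ha : ∀ n, |a n| ≤ 1)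
    (hβ : β ∈ Set.Icc (2 * K - 1 : ℝ) (2 * K + 1))
    (hroot : aeval β (horner (shadowDigit K a) (N + 1)) = 0) {n : ℕ} (hn : n < N) :
    β * |-aeval β (horner (shadowDigit K a) (n + 1)) - a n| < 8 := by
  have hsmall : |aeval β (horner (shadowDigit K a) (n + 2))| < 1 :=
    abs_aeval_horner_lt_one (fun m hm => (abs_shadowDigit_le hK ha hm).trans (by linarith [hβ.1]))
      hroot (by omega) (Nat.succ_le_succ hn)
  have hdigit := abs_shadowDigit_succ_add_le K a n
  have hdrift : |(2 * K - 4 - β) * a n| ≤ 5 := by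
    rw [abs_mul]
    exact (mul_le_of_le_one_right (abs_nonneg _) (ha n)).trans
      (abs_le.mpr ⟨by linarith [hβ.2], by linarith [hβ.1]⟩)
  have hsplit : β * (-aeval β (horner (shadowDigit K a) (n + 1)) - a n) =
      -aeval β (horner (shadowDigit K a) (n + 2)) -
        (shadowDigit K a (n + 1) + (2 * K - 4) * a n) + (2 * K - 4 - β) * a n := by
    rw [aeval_horner_succ _ _ (n + 1), algebraMap_int_eq, eq_intCast]
    ring
  have hβ0 : 0 ≤ β := by
    have : (2 : ℝ) ≤ K := by exact_mod_cast hK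
    linarith [hβ.1]
  rw [← abs_of_nonneg hβ0, ← abs_mul, abs_of_nonneg hβ0, hsplit, abs_lt]
  rw [abs_lt] at hsmall
  rw [abs_le] at hdigit hdrift
  constructor <;> linarith

end ShadowDigit

theorem exists_isSimple_Ealt_shadowing (hN : 1 ≤ N) {a : ℕ → ℝ} (ha : ∀ n, |a n| ≤ 1) {δ : ℝ}
    (hδ : 0 < δ) (B : ℝ) :
    ∃ β, B < β ∧ IsSimple β Ealt ∧ ∃ b : ℕ → ℝ, (∀ n < N, |b n - a n| < δ) ∧
      ∀ w : ℂ, aeval w (horner b N) = 0 → w ≠ β → w ∈ galoisConjugates β := by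
  obtain ⟨K, hK⟩ := exists_nat_gt (max 2 (max B (8 / δ)))
  obtain ⟨hK2, hKB, hKδ⟩ : (2 : ℝ) < K ∧ B < K ∧ 8 / δ < K := by simpa using hK
  have hK2' : 2 ≤ K := by exact_mod_cast hK2.le
  obtain ⟨β, hβ, hroot⟩ := exists_aeval_horner_eq_zero (c := shadowDigit K a) (L := 2 * K)
    (by simp [shadowDigit]) (fun n hn => abs_shadowDigit_le hK2' ha hn) N
  have hKβ : (K : ℝ) < β := by linarith [hβ.1]
  have hc (n : ℕ) (hn : 1 ≤ n) : |(shadowDigit K a n : ℝ)| ≤ β - 1 :=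
    (abs_shadowDigit_le hK2' ha hn).trans (by linarith [hβ.1])
  have hN4 : ¬ 4 ∣ shadowDigit K a N :=
    Nat.sub_add_cancel hN ▸ not_four_dvd_shadowDigit_succ K a (N - 1)
  refine ⟨β, hKB.trans hKβ,
    isSimple_Ealt_of_root (even_shadowDigit K a) hc hroot hN fun h => hN4 (h ▸ dvd_zero 4),
    fun n => -aeval β (horner (shadowDigit K a) (n + 1)), fun n hn => ?_, fun w hw hne =>
      mem_galoisConjugates_of_aeval_horner (even_shadowDigit K a) hN4 hroot hw hne⟩
  have hβ0 : 0 < β := by linarith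
  have hlt := mul_abs_neg_aeval_horner_shadowDigit_sub_lt hK2' ha hβ hroot hn
  have hδβ : 8 < β * δ := (div_lt_iff₀ hδ).mp (hKδ.trans hKβ)
  exact lt_of_mul_lt_mul_left (hlt.trans hδβ) hβ0.le

end Shadowing

section LowerInclusion

open Polynomial Filter Topology

theorem exists_pos_forall_exists_root_near {p : ℝ[X]} (hp : p.Monic) {w : ℂ} (hw : aeval w p = 0)
    {ε : ℝ} (hε : 0 < ε) :
    ∃ δ > 0, ∀ g : ℝ[X], g.Monic → g.natDegree = p.natDegree →
      (∀ i, |g.coeff i - p.coeff i| < δ) → ∃ z : ℂ, aeval z g = 0 ∧ ‖w - z‖ < ε := by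
  have hdeg : p.natDegree ≠ 0 :=
    (natDegree_pos_of_aeval_root hp.ne_zero hw fun x hx => by simpa using hx).ne'
  have hmax : 0 < max ‖w‖ 1 := lt_max_of_lt_right one_pos
  set δ : ℝ := (ε / max ‖w‖ 1) ^ p.natDegree / (p.natDegree + 1)
  have hδ : 0 < δ := by positivity
  have hbound : ((p.natDegree + 1) * δ) ^ (p.natDegree : ℝ)⁻¹ * max ‖w‖ 1 = ε := by
    rw [mul_div_cancel₀ _ (by positivity), Real.pow_rpow_inv_natCast (by positivity) hdeg,
      div_mul_cancel₀ _ hmax.ne']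
  refine ⟨δ, hδ, fun g hg hgdeg hcoeff => ?_⟩
  obtain ⟨z, hz, hzw⟩ := exists_aroots_norm_sub_lt_of_norm_coeff_sub_lt hδ hw hp hg hgdeg hcoeff
    (IsAlgClosed.splits _)
  exact ⟨z, (mem_aroots.mp hz).2, hzw.trans_eq hbound⟩

theorem mem_Phi_Ealt_of_root {p : ℝ[X]} (hp : p.Monic) (hcoeff : ∀ i, |p.coeff i| ≤ 1) {w : ℂ}
    (hw : aeval w p = 0) : w ∈ Phi Ealt := by
  set N := p.natDegree
  have hN1 : 1 ≤ N := natDegree_pos_of_aeval_root hp.ne_zero hw fun x hx => by simpa using hx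
  refine Metric.mem_closure_iff.mpr fun ε hε => ?_
  obtain ⟨δ, hδ, hnear⟩ := exists_pos_forall_exists_root_near hp hw hε
  obtain ⟨β, hβ, hsimple, b, hb, hconj⟩ := exists_isSimple_Ealt_shadowing hN1
    (a := fun n => -p.coeff (N - 1 - n)) (fun n => by simpa using hcoeff _) hδ (‖w‖ + ε)
  have hclose (i : ℕ) : |(horner b N).coeff i - p.coeff i| < δ := by
    rcases lt_or_ge i N with hi | hi
    · have hindex : N - 1 - (N - 1 - i) = i := by omega
      have hclose := hb (N - 1 - i) (by omega)
      rw [hindex, sub_neg_eq_add] at hclose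
      rwa [coeff_horner_of_lt b hi, ← neg_add', abs_neg]
    · suffices (horner b N).coeff i = p.coeff i by rwa [this, sub_self, abs_zero]
      rcases hi.eq_or_lt with hi | hi
      · rw [← hi, coeff_horner_self, hp.coeff_natDegree]
      · rw [coeff_eq_zero_of_natDegree_lt hi,
          coeff_eq_zero_of_natDegree_lt ((natDegree_horner b N).trans_lt hi)]
  obtain ⟨z, hz, hzw⟩ := hnear _ (horner_monic b N) (natDegree_horner b N) hclose
  refine ⟨z, ⟨β, hsimple, hconj z hz ?_⟩, by rwa [dist_eq_norm]⟩
  rintro rfl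
  have htri := norm_sub_norm_le (β : ℂ) w
  rw [norm_sub_rev, Complex.norm_real, Real.norm_eq_abs] at htri
  linarith [le_abs_self β]

/-- Over `ℝ`, the numbers `1` and `z` span `ℂ`, or at least `ℝ` if `z` is real. -/
theorem eventually_exists_small_coordinates {z : ℂ} {s : ℕ → ℂ} (hs : Tendsto s atTop (𝓝 0))
    (hreal : z.im = 0 → ∀ n, (s n).im = 0) {η : ℝ} (hη : 0 < η) :
    ∀ᶠ n in atTop, ∃ d₁ d₂ : ℝ, |d₁| < η ∧ |d₂| < η ∧ (d₁ : ℂ) + d₂ * z = s n := by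
  have hfst : Continuous fun s : ℂ => |s.re - s.im / z.im * z.re| := by fun_prop
  have hsnd : Continuous fun s : ℂ => |s.im / z.im| := by fun_prop
  have hfst0 := (hfst.tendsto 0).comp hs
  have hsnd0 := (hsnd.tendsto 0).comp hs
  simp only [Complex.zero_re, Complex.zero_im, zero_div, zero_mul, sub_zero, abs_zero]
    at hfst0 hsnd0
  filter_upwards [hfst0.eventually_lt_const hη, hsnd0.eventually_lt_const hη] with n h₁ h₂
  refine ⟨_, _, h₁, h₂, Complex.ext (by simp) ?_⟩
  rcases eq_or_ne z.im 0 with hz | hz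
  · simp [hz, hreal hz n]
  · simp [hz]

theorem ball_subset_Phi_Ealt : Metric.ball (0 : ℂ) 1 ⊆ Phi Ealt := by
  intro w hw
  have hpow : Tendsto (fun n : ℕ => w ^ (n + 2)) atTop (𝓝 0) :=
    (tendsto_add_atTop_iff_nat 2).mpr
      (tendsto_pow_atTop_nhds_zero_of_norm_lt_one (by simpa using hw))
  have hreal (h : w.im = 0) (n : ℕ) : (w ^ (n + 2)).im = 0 := by
    rw [← Complex.conj_eq_iff_im] at h ⊢
    rw [map_pow, h]
  obtain ⟨M, d₁, d₂, h₁, h₂, hd⟩ :=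
    (eventually_exists_small_coordinates hpow hreal one_pos).exists
  have hdeg : (C d₂ * X + C d₁).degree < ((M + 2 : ℕ) : WithBot ℕ) :=
    degree_linear_le.trans_lt (Nat.cast_lt.mpr (Nat.lt_add_left M one_lt_two))
  refine mem_Phi_Ealt_of_root (monic_X_pow_sub hdeg) (fun i => ?_) (w := w) ?_
  · rcases i with _ | _ | i
    · simpa using h₁.le
    · simpa [coeff_X_pow] using h₂.le
    · have htail : (C d₂ * X + C d₁).coeff (i + 2) = 0 := by simp
      rw [coeff_sub, htail, sub_zero, coeff_X_pow]
      split_ifs <;> simp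
  · simp [← hd, add_comm]

/-- Room between `|b n|` and `1` lets the first two coefficients absorb the tail of the series. -/
theorem inv_mem_Phi_Ealt_of_hasSum {z : ℂ} {b : ℕ → ℝ} {η : ℝ} (hη : 0 < η)
    (hb : ∀ n, |b n| ≤ 1 - η) (hsum : HasSum (fun n => (b n : ℂ) * z ^ (n + 1)) 1) :
    z⁻¹ ∈ Phi Ealt := by
  have hz : z ≠ 0 := by
    rintro rfl
    simpa using hsum.tsum_eq
  set s : ℕ → ℂ := fun N => (1 - ∑ i ∈ Finset.range N, (b i : ℂ) * z ^ (i + 1)) / z with hs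
  have hs0 : Tendsto s atTop (𝓝 0) := by
    simpa using (hsum.tendsto_sum_nat.const_sub 1).div_const z
  have hreal (h : z.im = 0) (N : ℕ) : (s N).im = 0 := by
    rw [← Complex.conj_eq_iff_im] at h ⊢
    simp [hs, h]
  obtain ⟨N, ⟨d₁, d₂, h₁, h₂, hd⟩, hN⟩ :=
    ((eventually_exists_small_coordinates hs0 hreal hη).and (eventually_ge_atTop 2)).exists
  set c : ℕ → ℝ := fun n => if n = 0 then d₁ else if n = 1 then d₂ else 0 with hc
  have hcη (n : ℕ) : |c n| ≤ η := by
    simp only [hc]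
    split_ifs <;> [exact h₁.le; exact h₂.le; exact abs_zero.trans_le hη.le]
  have hbc (n : ℕ) : |(b + c) n| ≤ 1 :=
    (abs_add_le _ _).trans ((add_le_add (hb n) (hcη n)).trans_eq (sub_add_cancel 1 η))
  refine mem_Phi_Ealt_of_root (horner_monic (b + c) N) (abs_coeff_horner_le hbc N) ?_
  have hcsum : ∑ i ∈ Finset.range N, (c i : ℂ) * z ^ (i + 1) = s N * z := by
    obtain ⟨M, rfl⟩ := Nat.exists_eq_add_of_le' hN
    rw [Finset.sum_range_succ', Finset.sum_range_succ', Finset.sum_eq_zero, ← hd]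
    · simp only [hc, zero_add, one_ne_zero, ↓reduceIte, Nat.reduceAdd, pow_one]
      ring
    · intro i _
      simp [hc]
  rw [aeval_horner_eq_pow_mul _ (inv_ne_zero hz), inv_inv]
  refine mul_eq_zero_of_right _ ?_
  simp only [Pi.add_apply, map_add, add_mul, Finset.sum_add_distrib, Complex.coe_algebraMap]
  rw [hcsum, hs, div_mul_cancel₀ _ hz]
  ring

theorem ofReal_mul_inv_mem_Phi_Ealt {z : ℂ} {f : PowerSeries ℝ} (hf : f ∈ FF (Set.Icc (-1) 1))
    (hsum : HasSum (fun n => ((PowerSeries.coeff n f : ℝ) : ℂ) * z ^ n) 0) {t : ℝ}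
    (ht : t ∈ Set.Ioo 0 1) : t * z⁻¹ ∈ Phi Ealt := by
  have hsum' : HasSum (fun n => ((-PowerSeries.coeff (n + 1) f : ℝ) : ℂ) * z ^ (n + 1)) 1 := by
    simpa [hf.1] using ((hasSum_nat_add_iff' 1).mpr hsum).neg
  have ht0 : (t : ℂ) ≠ 0 := Complex.ofReal_ne_zero.mpr ht.1.ne'
  rw [← div_eq_mul_inv, ← inv_div]
  refine inv_mem_Phi_Ealt_of_hasSum (η := 1 - t) (sub_pos.mpr ht.2)
    (b := fun n => -PowerSeries.coeff (n + 1) f * t ^ (n + 1)) (fun n => ?_) ?_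
  · have hcoeff : |PowerSeries.coeff (n + 1) f| ≤ 1 := abs_le.mpr (hf.2 (n + 1) n.succ_pos)
    have hpow : t ^ (n + 1) ≤ t := pow_le_of_le_one ht.1.le ht.2.le n.succ_ne_zero
    rw [abs_mul, abs_neg, abs_of_pos (pow_pos ht.1 _), sub_sub_cancel]
    exact (mul_le_of_le_one_left (pow_pos ht.1 _).le hcoeff).trans hpow
  · convert hsum' using 2 with n
    rw [div_pow]
    push_cast
    field_simp

theorem invSet_GG_subset_Phi_Ealt : invSet (GG (Set.Icc (-1 : ℝ) 1)) ⊆ Phi Ealt := by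
  rintro _ ⟨z, ⟨-, f, hf, hsum⟩, rfl⟩
  have hmem : ∀ᶠ t : ℝ in 𝓝[<] 1, t * z⁻¹ ∈ Phi Ealt := by
    filter_upwards [Ioo_mem_nhdsLT one_pos] with t ht
    exact ofReal_mul_inv_mem_Phi_Ealt hf hsum ht
  have hlim : Tendsto (fun t : ℝ => (t : ℂ) * z⁻¹) (𝓝[<] 1) (𝓝 z⁻¹) := by
    have hcont : Continuous fun t : ℝ => (t : ℂ) * z⁻¹ := by fun_prop
    simpa using (hcont.tendsto 1).mono_left nhdsWithin_le_nhds
  exact isClosed_closure.mem_of_tendsto hlim hmem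

theorem conjRegion_subset_Phi_Ealt : conjRegion ⊆ Phi Ealt :=
  Set.union_subset (closure_minimal ball_subset_Phi_Ealt isClosed_closure)
    invSet_GG_subset_Phi_Ealt

end LowerInclusion

theorem Phi_subset_conjRegion (E : ℕ → Fin 2) : Phi E ⊆ conjRegion :=
  (Phi_subset_PhiHat E).trans (PhiHat_subset_conjRegion E)

theorem Phi_Ealt_eq_conjRegion : Phi Ealt = conjRegion :=
  (Phi_subset_conjRegion Ealt).antisymm conjRegion_subset_Phi_Ealt

theorem PhiHat_Ealt_eq_conjRegion : PhiHat Ealt = conjRegion :=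
  (PhiHat_subset_conjRegion Ealt).antisymm
    (conjRegion_subset_Phi_Ealt.trans (Phi_subset_PhiHat Ealt))

theorem PhiStar_Ealt_eq_conjRegion : PhiStar Ealt = conjRegion :=
  (PhiStar_subset_conjRegion Ealt).antisymm
    (conjRegion_subset_Phi_Ealt.trans (Phi_subset_PhiStar Ealt))

end GenBeta

theorem theorem2p5 :
    GenBeta.Phi GenBeta.Ealt = GenBeta.PhiHat GenBeta.Ealt ∧
    GenBeta.PhiHat GenBeta.Ealt = GenBeta.PhiStar GenBeta.Ealt ∧
    GenBeta.PhiStar GenBeta.Ealt =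
      closure (Metric.ball (0 : ℂ) 1) ∪ GenBeta.invSet (GenBeta.GG (Set.Icc (-1 : ℝ) 1)) ∧
    GenBeta.Phi GenBeta.Ealt = ⋃ E : ℕ → Fin 2, GenBeta.Phi E := by
  have hPhi := GenBeta.Phi_Ealt_eq_conjRegion
  have hPhiHat := GenBeta.PhiHat_Ealt_eq_conjRegion
  have hPhiStar := GenBeta.PhiStar_Ealt_eq_conjRegion
  refine ⟨hPhi.trans hPhiHat.symm, hPhiHat.trans hPhiStar.symm, hPhiStar, ?_⟩
  exact (Set.subset_iUnion GenBeta.Phi GenBeta.Ealt).antisymm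
    (Set.iUnion_subset fun E => (GenBeta.Phi_subset_conjRegion E).trans hPhi.superset)
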